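/- Let $\mathrm{SE}(3)=\mathbb R^3\rtimes \mathrm{SO}(3)$, a six-dimensional Lie group with multiplication $(a,R)(a',R')=(a+Ra',RR')$, act on itself by left multiplication. Let $X$ be a smooth manifold with a smooth action of $\mathrm{SE}(3)$, and let \[ p_1,p_2\colon \mathrm{SE}(3)\to X \] be smooth $\mathrm{SE}(3)$-equivariant surjective submersions. Let \[ P=\mathrm{SE}(3)\times_X\mathrm{SE}(3)=\{(g_1,g_2)\in \mathrm{SE}(3)\times\mathrm{SE}(3) : p_1(g_1)=p_2(g_2)\} \] be their fibred product, with its smooth structure as an embedded submanifold of $\mathrm{SE}(3)\times\mathrm{SE}(3)$ (equivalently, as the pullback of $p_1$ and $p_2$ in the category of smooth manifolds), and with the diagonal action $g\cdot(g_1,g_2)=(gg_1,gg_2)$. Let $\mathrm{SE}(3)$ act on $\mathrm{SE}(3)\times S^1\times S^1$ by left multiplication on the first factor, $g\cdot(h,s,t)=(gh,s,t)$. Then, for every choice of $X$, $p_1$ and $p_2$, there is no $\mathrm{SE}(3)$-equivariant diffeomorphism from $P$ to $\mathrm{SE}(3)\times S^1\times S^1$. (In this sense the universal joint, whose configuration space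 is $\mathrm{SE}(3)\times S^1\times S^1$, has no realization by two actors $\mathrm{SE}(3)$ that are coupled through a common $\mathrm{SE}(3)$-equivariant constraint.) -/

import Mathlib

open scoped Manifold ContDiff Matrix
open Manifold

/-- Euclidean space `ℝ³`. -/
abbrev E3 : Type := EuclideanSpace ℝ (Fin 3)
/-- The group `SO(3)` of real orthogonal `3 × 3` matrices of determinant one. -/
abbrev SO3 : Type := Matrix.specialOrthogonalGroup (Fin 3) ℝ

namespace SO3

/-- The rotation with Rodrigues vector `w`, that is, the rotation about the axis `w` by the angle
`2 arctan ‖w‖`; it is the Cayley transform of the skew-symmetric matrix `v ↦ w × v`. -/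
noncomputable def rodrigues (w : E3) : Matrix (Fin 3) (Fin 3) ℝ :=
  (1 + w 0 ^ 2 + w 1 ^ 2 + w 2 ^ 2)⁻¹ •
    !![1 + w 0 ^ 2 - w 1 ^ 2 - w 2 ^ 2, 2 * (w 0 * w 1 - w 2), 2 * (w 0 * w 2 + w 1);
      2 * (w 0 * w 1 + w 2), 1 - w 0 ^ 2 + w 1 ^ 2 - w 2 ^ 2, 2 * (w 1 * w 2 - w 0);
      2 * (w 0 * w 2 - w 1), 2 * (w 1 * w 2 + w 0), 1 - w 0 ^ 2 - w 1 ^ 2 + w 2 ^ 2]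

/-- The Rodrigues vector of a rotation `R` by an angle other than `π` (equivalently, with
`1 + tr R ≠ 0`). -/
noncomputable def rodriguesCoord (R : Matrix (Fin 3) (Fin 3) ℝ) : E3 :=
  !₂[(R 2 1 - R 1 2) / (1 + R.trace), (R 0 2 - R 2 0) / (1 + R.trace),
    (R 1 0 - R 0 1) / (1 + R.trace)]

theorem one_add_pos (w : E3) : 0 < 1 + w 0 ^ 2 + w 1 ^ 2 + w 2 ^ 2 := by positivity

theorem rodrigues_mem (w : E3) : rodrigues w ∈ Matrix.specialOrthogonalGroup (Fin 3) ℝ := by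
  have h := (one_add_pos w).ne'
  rw [Matrix.mem_specialOrthogonalGroup_iff, Matrix.mem_orthogonalGroup_iff]
  constructor
  · ext i j
    fin_cases i <;> fin_cases j <;>
      simp [rodrigues, Matrix.mul_apply, Fin.sum_univ_three] <;>
      field_simp <;> ring
  · rw [Matrix.det_fin_three]
    simp [rodrigues]
    field_simp
    ring

theorem one_add_trace_rodrigues (w : E3) :
    1 + (rodrigues w).trace = 4 / (1 + w 0 ^ 2 + w 1 ^ 2 + w 2 ^ 2) := by
  have h := (one_add_pos w).ne'
  simp [rodrigues, Matrix.trace_fin_three]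
  field_simp
  ring

theorem rodriguesCoord_rodrigues (w : E3) : rodriguesCoord (rodrigues w) = w := by
  have h := (one_add_pos w).ne'
  ext i
  fin_cases i <;> simp only [rodriguesCoord, one_add_trace_rodrigues] <;>
    simp [rodrigues] <;> field_simp <;> ring

theorem rodrigues_rodriguesCoord (R : SO3) (hR : 1 + R.1.trace ≠ 0) :
    rodrigues (rodriguesCoord R.1) = R.1 := by
  obtain ⟨R, h⟩ := R
  have h' := h
  rw [Matrix.mem_specialOrthogonalGroup_iff, Matrix.mem_orthogonalGroup_iff'] at h
  obtain ⟨h1, hd⟩ := h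
  change Rᵀ * R = 1 at h1
  have h2 : R * Rᵀ = 1 := by
    rw [Matrix.mem_specialOrthogonalGroup_iff, Matrix.mem_orthogonalGroup_iff] at h'
    exact h'.1
  have hadj : R.adjugate = Rᵀ := by
    have := Matrix.mul_adjugate R
    rw [hd, one_smul] at this
    calc R.adjugate = (Rᵀ * R) * R.adjugate := by rw [h1, one_mul]
      _ = Rᵀ := by rw [mul_assoc, this, mul_one]
  have a (i j) := congrFun (congrFun hadj i) j
  have b (i j) := congrFun (congrFun h1 i) j
  have c (i j) := congrFun (congrFun h2 i) j
  simp only [Matrix.adjugate_fin_three] at a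
  simp only [Matrix.mul_apply, Fin.sum_univ_three, Matrix.transpose_apply] at a b c
  have a00 := a 0 0
  have a01 := a 0 1
  have a02 := a 0 2
  have a10 := a 1 0
  have a11 := a 1 1
  have a12 := a 1 2
  have a20 := a 2 0
  have a21 := a 2 1
  have a22 := a 2 2
  have b00 := b 0 0
  have b01 := b 0 1
  have b02 := b 0 2
  have b11 := b 1 1
  have b12 := b 1 2
  have b22 := b 2 2
  have c00 := c 0 0
  have c01 := c 0 1
  have c02 := c 0 2
  have c11 := c 1 1
  have c12 := c 1 2
  have c22 := c 2 2
  clear a b c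
  simp at a00 a01 a02 a10 a11 a12 a20 a21 a22 b00 b01 b02 b11 b12 b22 c00 c01 c02 c11 c12 c22
  simp only [Matrix.trace_fin_three] at hR
  have key : 1 + ((R 2 1 - R 1 2) / (1 + R.trace)) ^ 2 + ((R 0 2 - R 2 0) / (1 + R.trace)) ^ 2 +
      ((R 1 0 - R 0 1) / (1 + R.trace)) ^ 2 = 4 / (1 + R.trace) := by
    simp only [Matrix.trace_fin_three]
    field_simp
    linarith
  ext i j
  simp only [rodrigues, rodriguesCoord]
  simp only [Matrix.cons_val, Matrix.cons_val_zero, Matrix.cons_val_one, key,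
    Matrix.smul_apply]
  simp only [Matrix.trace_fin_three]
  fin_cases i <;> fin_cases j <;> simp <;> field_simp <;> linarith

theorem contDiff_rodrigues_apply (i j : Fin 3) : ContDiff ℝ ∞ fun w => rodrigues w i j := by
  have h (w : E3) := (one_add_pos w).ne'
  fin_cases i <;> fin_cases j <;> simp [rodrigues] <;> fun_prop (disch := exact h)

theorem continuous_rodrigues : Continuous rodrigues :=
  continuous_matrix fun i j => (contDiff_rodrigues_apply i j).continuous

theorem continuousOn_rodriguesCoord :
    ContinuousOn rodriguesCoord {R : Matrix (Fin 3) (Fin 3) ℝ | 1 + R.trace ≠ 0} := by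
  have h (i j : Fin 3) : Continuous fun R : Matrix (Fin 3) (Fin 3) ℝ => R i j :=
    continuous_id.matrix_elem i j
  have ht : Continuous fun R : Matrix (Fin 3) (Fin 3) ℝ => 1 + R.trace :=
    continuous_const.add continuous_id.matrix_trace
  refine (PiLp.continuous_toLp 2 _).comp_continuousOn (continuousOn_pi.2 fun i => ?_)
  fin_cases i
  · exact ((h 2 1).sub (h 1 2)).continuousOn.div ht.continuousOn fun R hR => hR
  · exact ((h 0 2).sub (h 2 0)).continuousOn.div ht.continuousOn fun R hR => hR
  · exact ((h 1 0).sub (h 0 1)).continuousOn.div ht.continuousOn fun R hR => hR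

/-- The chart of `SO(3)` centred at `A`: the Rodrigues vector of `A⁻¹ R`. -/
noncomputable def chart (A : SO3) : OpenPartialHomeomorph SO3 E3 where
  toFun R := rodriguesCoord (A⁻¹ * R : SO3).1
  invFun w := A * ⟨rodrigues w, rodrigues_mem w⟩
  source := {R | 1 + (A⁻¹ * R : SO3).1.trace ≠ 0}
  target := Set.univ
  map_source' _ _ := Set.mem_univ _
  map_target' w _ := by
    simp only [inv_mul_cancel_left, Set.mem_ofPred_eq, one_add_trace_rodrigues]
    have := one_add_pos w
    positivity
  left_inv' R hR := by
    have : (⟨_, rodrigues_mem (rodriguesCoord (A⁻¹ * R : SO3).1)⟩ : SO3) = A⁻¹ * R :=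
      Subtype.ext (rodrigues_rodriguesCoord _ hR)
    rw [this, mul_inv_cancel_left]
  right_inv' w _ := by
    simp only [inv_mul_cancel_left, rodriguesCoord_rodrigues]
  open_source := by
    refine isOpen_ne.preimage (continuous_const.add (Continuous.matrix_trace ?_))
    exact continuous_const.matrix_mul continuous_subtype_val
  open_target := isOpen_univ
  continuousOn_toFun := by
    refine continuousOn_rodriguesCoord.comp (Continuous.continuousOn ?_) fun R hR => hR
    exact continuous_const.matrix_mul continuous_subtype_val
  continuousOn_invFun := by
    refine (Continuous.subtype_mk ?_ _).continuousOn
    exact continuous_const.matrix_mul continuous_rodrigues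

theorem mem_chart_source (A : SO3) : A ∈ (chart A).source := by
  change 1 + (A⁻¹ * A : SO3).1.trace ≠ 0
  simp
  norm_num

noncomputable instance : ChartedSpace E3 SO3 where
  atlas := Set.range chart
  chartAt := chart
  mem_chart_source := mem_chart_source
  chart_mem_atlas A := Set.mem_range_self A

theorem contMDiffOn_rodriguesCoord {E H M : Type*} [NormedAddCommGroup E] [NormedSpace ℝ E]
    [TopologicalSpace H] {I : ModelWithCorners ℝ E H} [TopologicalSpace M] [ChartedSpace H M]
    {s : Set M} {f : M → Matrix (Fin 3) (Fin 3) ℝ}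
    (hf : ∀ i j, ContMDiffOn I 𝓘(ℝ, ℝ) ∞ (fun x => f x i j) s)
    (hs : ∀ x ∈ s, 1 + (f x).trace ≠ 0) :
    ContMDiffOn I (𝓡 3) ∞ (fun x => rodriguesCoord (f x)) s := by
  have ht : ContMDiffOn I 𝓘(ℝ, ℝ) ∞ (fun x => 1 + (f x).trace) s := by
    simp only [Matrix.trace_fin_three]
    exact contMDiffOn_const.add (((hf 0 0).add (hf 1 1)).add (hf 2 2))
  have hp : ContMDiffOn I 𝓘(ℝ, Fin 3 → ℝ) ∞ (fun x => (rodriguesCoord (f x)).ofLp) s := by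
    rw [contMDiffOn_pi_space]
    intro i
    fin_cases i
    · exact ((hf 2 1).sub (hf 1 2)).div₀ ht hs
    · exact ((hf 0 2).sub (hf 2 0)).div₀ ht hs
    · exact ((hf 1 0).sub (hf 0 1)).div₀ ht hs
  exact (PiLp.contDiff_toLp (𝕜 := ℝ) (n := ∞) (p := 2)).contMDiff.comp_contMDiffOn hp

theorem contMDiffOn_mul_apply {E H M : Type*} [NormedAddCommGroup E] [NormedSpace ℝ E]
    [TopologicalSpace H] {I : ModelWithCorners ℝ E H} [TopologicalSpace M] [ChartedSpace H M]
    {s : Set M} {f g : M → Matrix (Fin 3) (Fin 3) ℝ}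
    (hf : ∀ i j, ContMDiffOn I 𝓘(ℝ, ℝ) ∞ (fun x => f x i j) s)
    (hg : ∀ i j, ContMDiffOn I 𝓘(ℝ, ℝ) ∞ (fun x => g x i j) s) (i j : Fin 3) :
    ContMDiffOn I 𝓘(ℝ, ℝ) ∞ (fun x => (f x * g x) i j) s := by
  simp only [Matrix.mul_apply, Fin.sum_univ_three]
  exact (((hf i 0).mul (hg 0 j)).add ((hf i 1).mul (hg 1 j))).add ((hf i 2).mul (hg 2 j))

theorem contMDiff_chart_symm_apply (A : SO3) (i j : Fin 3) :
    ContMDiff (𝓡 3) 𝓘(ℝ, ℝ) ∞ fun w => ((chart A).symm w).1 i j :=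
  contMDiffOn_univ.1 <| contMDiffOn_mul_apply (f := fun _ => A.1) (fun _ _ => contMDiffOn_const)
    (fun i j => (contDiff_rodrigues_apply i j).contMDiff.contMDiffOn) i j

instance : IsManifold (𝓡 3) ∞ SO3 := by
  refine isManifold_of_contDiffOn _ _ _ ?_
  rintro _ _ ⟨A, rfl⟩ ⟨B, rfl⟩
  simp only [modelWithCornersSelf_coe, modelWithCornersSelf_coe_symm, Function.comp_id,
    Function.id_comp, Set.range_id, Set.inter_univ, Set.preimage_id_eq, id_eq]
  rw [← contMDiffOn_iff_contDiffOn]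
  refine contMDiffOn_rodriguesCoord (contMDiffOn_mul_apply (fun _ _ => contMDiffOn_const)
    fun i j => (contMDiff_chart_symm_apply A i j).contMDiffOn) ?_
  intro w hw
  exact hw.2

/-- The smooth structure on `SO(3)` is the one induced from the space of matrices. -/
theorem contMDiff_iff {E H M : Type*} [NormedAddCommGroup E] [NormedSpace ℝ E]
    [TopologicalSpace H] {I : ModelWithCorners ℝ E H} [TopologicalSpace M] [ChartedSpace H M]
    {f : M → SO3} :
    ContMDiff I (𝓡 3) ∞ f ↔ ∀ i j, ContMDiff I 𝓘(ℝ, ℝ) ∞ fun x => (f x).1 i j := by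
  constructor
  · intro hf i j
    have h : ContMDiff (𝓡 3) 𝓘(ℝ, ℝ) ∞ fun R : SO3 => R.1 i j := by
      intro A
      have h1 : ContMDiffOn (𝓡 3) (𝓡 3) ∞ (chart A) (chart A).source :=
        contMDiffOn_chart (x := A)
      have h2 := ((contMDiff_chart_symm_apply A i j).comp_contMDiffOn h1).congr
        (f₁ := fun R : SO3 => R.1 i j) fun R hR => by
          simp only [Function.comp, (chart A).left_inv hR]
      exact h2.contMDiffAt ((chart A).open_source.mem_nhds (mem_chart_source A))
    exact h.comp hf
  · intro hf x
    have hc : Continuous f := (continuous_matrix fun i j => (hf i j).continuous).subtype_mk _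
    have ho : IsOpen (f ⁻¹' (chart (f x)).source) := (chart (f x)).open_source.preimage hc
    have h1 : ContMDiffOn I (𝓡 3) ∞ (fun y => chart (f x) (f y)) (f ⁻¹' (chart (f x)).source) :=
      contMDiffOn_rodriguesCoord (contMDiffOn_mul_apply (fun _ _ => contMDiffOn_const)
        fun i j => (hf i j).contMDiffOn) fun y hy => hy
    have h2 : ContMDiffOn (𝓡 3) (𝓡 3) ∞ (chart (f x)).symm (chart (f x)).target :=
      contMDiffOn_chart_symm (x := f x)
    have h3 := (h2.comp h1 fun y hy => (chart (f x)).map_source hy).congr (f₁ := f) fun y hy => by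
      simp only [Function.comp, (chart (f x)).left_inv hy]
    exact h3.contMDiffAt (ho.mem_nhds (mem_chart_source (f x)))

instance : LieGroup (𝓡 3) ∞ SO3 where
  contMDiff_mul := by
    rw [contMDiff_iff]
    have h1 := contMDiff_iff.1
      (contMDiff_fst (I := 𝓡 3) (J := 𝓡 3) (M := SO3) (N := SO3) (n := ∞))
    have h2 := contMDiff_iff.1
      (contMDiff_snd (I := 𝓡 3) (J := 𝓡 3) (M := SO3) (N := SO3) (n := ∞))
    exact fun i j => contMDiffOn_univ.1 <| contMDiffOn_mul_apply
      (fun i j => (h1 i j).contMDiffOn) (fun i j => (h2 i j).contMDiffOn) i j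
  contMDiff_inv := by
    rw [contMDiff_iff]
    intro i j
    exact contMDiff_iff.1 (contMDiff_id (I := 𝓡 3) (M := SO3) (n := ∞)) j i

end SO3

/-- The special Euclidean group `SE(3) = ℝ³ ⋊ SO(3)`: the pair `(a, R)` is the rigid motion
`v ↦ a + R v`. -/
def SE3 : Type := E3 × SO3

namespace SE3

instance : TopologicalSpace SE3 := inferInstanceAs (TopologicalSpace (E3 × SO3))

noncomputable instance : ChartedSpace (ModelProd E3 E3) SE3 :=
  inferInstanceAs (ChartedSpace (ModelProd E3 E3) (E3 × SO3))

/-- The action of `SO(3)` on `ℝ³`. -/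
noncomputable def rotate (R : SO3) (v : E3) : E3 := WithLp.toLp 2 (R.1 *ᵥ v.ofLp)

theorem rotate_mul (R S : SO3) (v : E3) : rotate (R * S) v = rotate R (rotate S v) := by
  simp [rotate]

theorem rotate_one (v : E3) : rotate 1 v = v := by simp [rotate]

theorem rotate_add (R : SO3) (v w : E3) : rotate R (v + w) = rotate R v + rotate R w := by
  simp [rotate, Matrix.mulVec_add]

/-- `(a, R) (a', R') = (a + R a', R R')`. -/
noncomputable instance : Mul SE3 := ⟨fun g h => (g.1 + rotate g.2 h.1, g.2 * h.2)⟩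
noncomputable instance : One SE3 := ⟨((0 : E3), (1 : SO3))⟩
noncomputable instance : Inv SE3 := ⟨fun g => (-rotate g.2⁻¹ g.1, g.2⁻¹)⟩

theorem mul_fst (g h : SE3) : (g * h).1 = g.1 + rotate g.2 h.1 := rfl
theorem mul_snd (g h : SE3) : (g * h).2 = g.2 * h.2 := rfl
theorem one_fst : (1 : SE3).1 = 0 := rfl
theorem one_snd : (1 : SE3).2 = 1 := rfl
theorem inv_fst (g : SE3) : (g⁻¹).1 = -rotate g.2⁻¹ g.1 := rfl
theorem inv_snd (g : SE3) : (g⁻¹).2 = g.2⁻¹ := rfl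

noncomputable instance : Group SE3 :=
  Group.ofLeftAxioms
    (fun a b c => Prod.ext (by simp [mul_fst, mul_snd, rotate_mul, rotate_add, add_assoc])
      (by simp [mul_snd, mul_assoc]))
    (fun a => Prod.ext (by simp [mul_fst, one_fst, one_snd, rotate_one])
      (by simp [mul_snd, one_snd]))
    (fun a => Prod.ext (by simp [mul_fst, one_fst, inv_fst, inv_snd])
      (by simp [mul_snd, one_snd, inv_snd]))

/-- The model with corners of the six-dimensional manifold `SE(3)`. -/
noncomputable abbrev model : ModelWithCorners ℝ (E3 × E3) (ModelProd E3 E3) := (𝓡 3).prod (𝓡 3)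

instance : IsManifold model ∞ SE3 := inferInstanceAs (IsManifold model ∞ (E3 × SO3))

theorem contMDiff_rotate {E H M : Type*} [NormedAddCommGroup E] [NormedSpace ℝ E]
    [TopologicalSpace H] {I : ModelWithCorners ℝ E H} [TopologicalSpace M] [ChartedSpace H M]
    {f : M → SO3} {v : M → E3} (hf : ContMDiff I (𝓡 3) ∞ f) (hv : ContMDiff I (𝓡 3) ∞ v) :
    ContMDiff I (𝓡 3) ∞ fun x => rotate (f x) (v x) := by
  have hf' := SO3.contMDiff_iff.1 hf
  have hv' : ∀ i, ContMDiff I 𝓘(ℝ, ℝ) ∞ fun x => v x i := fun i =>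
    (contDiff_euclidean.1 contDiff_id i).contMDiff.comp hv
  have hp : ContMDiff I 𝓘(ℝ, Fin 3 → ℝ) ∞ fun x => (f x).1 *ᵥ (v x).ofLp := by
    rw [contMDiff_pi_space]
    intro i
    simp only [Matrix.mulVec, dotProduct, Fin.sum_univ_three]
    exact (((hf' i 0).mul (hv' 0)).add ((hf' i 1).mul (hv' 1))).add ((hf' i 2).mul (hv' 2))
  exact (PiLp.contDiff_toLp (𝕜 := ℝ) (n := ∞) (p := 2)).contMDiff.comp hp

theorem contMDiff_fst' : ContMDiff model (𝓡 3) ∞ fun g : SE3 => g.1 :=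
  contMDiff_fst (I := 𝓡 3) (J := 𝓡 3) (M := E3) (N := SO3) (n := ∞)

theorem contMDiff_snd' : ContMDiff model (𝓡 3) ∞ fun g : SE3 => g.2 :=
  contMDiff_snd (I := 𝓡 3) (J := 𝓡 3) (M := E3) (N := SO3) (n := ∞)

instance : LieGroup model ∞ SE3 where
  contMDiff_mul := by
    have h1 := contMDiff_fst (I := model) (J := model) (M := SE3) (N := SE3) (n := ∞)
    have h2 := contMDiff_snd (I := model) (J := model) (M := SE3) (N := SE3) (n := ∞)
    exact ((contMDiff_fst'.comp h1).add
      (contMDiff_rotate (contMDiff_snd'.comp h1) (contMDiff_fst'.comp h2))).prodMk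
      ((contMDiff_snd'.comp h1).mul (contMDiff_snd'.comp h2))
  contMDiff_inv :=
    (contMDiff_rotate contMDiff_snd'.inv contMDiff_fst').neg.prodMk contMDiff_snd'.inv

end SE3

section FiberProduct

variable {n : ℕ} {X : Type*} [TopologicalSpace X] [ChartedSpace (EuclideanSpace ℝ (Fin n)) X]
  [MulAction SE3 X]

/-- A smooth `SE(3)`-equivariant surjective submersion `SE(3) → X`, where `SE(3)` acts on itself by
left multiplication. -/
structure EquivariantSurjectiveSubmersion (n : ℕ) (X : Type*) [TopologicalSpace X]
    [ChartedSpace (EuclideanSpace ℝ (Fin n)) X] [MulAction SE3 X] where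
  toFun : SE3 → X
  isSubmersion : IsSubmersion SE3.model (𝓡 n) ∞ toFun
  surjective : Function.Surjective toFun
  map_smul : ∀ g h : SE3, toFun (g • h) = g • toFun h

/-- The fibred product `SE(3) ×_X SE(3)`, as the set of all `(a, b)` with `p₁ a = p₂ b`. -/
structure FiberProduct (p₁ p₂ : EquivariantSurjectiveSubmersion n X) : Type where
  val : SE3 × SE3
  property : p₁.toFun val.1 = p₂.toFun val.2

namespace FiberProduct

variable {p₁ p₂ : EquivariantSurjectiveSubmersion n X}

/-- The subspace topology. -/
instance : TopologicalSpace (FiberProduct p₁ p₂) := TopologicalSpace.induced val inferInstance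

theorem isInducing_val : Topology.IsInducing (val : FiberProduct p₁ p₂ → SE3 × SE3) := ⟨rfl⟩

theorem ext' {x y : FiberProduct p₁ p₂} (h₁ : x.val.1 = y.val.1) (h₂ : x.val.2 = y.val.2) :
    x = y := by
  obtain ⟨⟨a, b⟩, _⟩ := x
  obtain ⟨⟨c, d⟩, _⟩ := y
  simp only at h₁ h₂
  subst h₁ h₂
  rfl

/-- The diagonal action of `SE(3)`. -/
noncomputable instance : MulAction SE3 (FiberProduct p₁ p₂) where
  smul g x := ⟨(g • x.val.1, g • x.val.2), by
    rw [p₁.map_smul, p₂.map_smul]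
    exact congrArg (g • ·) x.property⟩
  one_smul x := ext' (one_smul SE3 x.val.1) (one_smul SE3 x.val.2)
  mul_smul g h x := ext' (mul_smul g h x.val.1) (mul_smul g h x.val.2)

theorem isSubmersionOfComplement (p : EquivariantSurjectiveSubmersion n X) :
    IsSubmersionOfComplement (EuclideanSpace ℝ (Fin (6 - n))) SE3.model (𝓡 n) ∞ p.toFun := by
  obtain ⟨F, _, _, h⟩ := p.isSubmersion
  have e := (h 1).equiv
  have : FiniteDimensional ℝ (EuclideanSpace ℝ (Fin n) × F) := e.toLinearEquiv.finiteDimensional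
  have : FiniteDimensional ℝ F :=
    FiniteDimensional.of_surjective (LinearMap.snd ℝ (EuclideanSpace ℝ (Fin n)) F)
      LinearMap.snd_surjective
  refine h.trans_F (ContinuousLinearEquiv.ofFinrankEq ?_)
  have h6 := e.toLinearEquiv.finrank_eq
  simp only [Module.finrank_prod, finrank_euclideanSpace, Fintype.card_fin] at h6 ⊢
  omega

/-- The model space of the fibred product, of dimension `12 - n`. -/
abbrev ModelSpace (n : ℕ) : Type := (E3 × E3) × EuclideanSpace ℝ (Fin (6 - n))

/-- Near `x`, the second projection reads `(u, v) ↦ u` in suitable charts of `SE(3)` and `X`. Hence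
a point `(a, b)` of the fibred product near `x` is determined by the coordinates of `a` and the
`v`-coordinate of `b`. -/
noncomputable def chart (x : FiberProduct p₁ p₂) :
    OpenPartialHomeomorph (FiberProduct p₁ p₂) (ModelSpace n) := by
  classical
  exact
  let h := isSubmersionOfComplement p₂ x.val.2
  let χ : OpenPartialHomeomorph SE3 (E3 × E3) := chartAt (ModelProd E3 E3) x.val.1
  let φ : OpenPartialHomeomorph SE3 (E3 × E3) := h.domChart
  let ψ := h.codChart
  let e := h.equiv
  have hφ : ∀ v ∈ φ.target, ψ (p₂.toFun (φ.symm v)) = (e v).1 := by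
    intro v hv
    refine h.writtenInCharts (?_ : v ∈ _)
    rw [OpenPartialHomeomorph.extend_target]
    exact ⟨hv, ⟨v, rfl⟩⟩
  have hψ : ∀ b ∈ φ.source, p₂.toFun b ∈ ψ.source := fun b hb => h.source_subset_preimage_source hb
  have hb : ∀ w : ModelSpace n, p₁.toFun (χ.symm w.1) ∈ ψ.source →
      e.symm (ψ (p₁.toFun (χ.symm w.1)), w.2) ∈ φ.target →
      p₁.toFun (χ.symm w.1) = p₂.toFun (φ.symm (e.symm (ψ (p₁.toFun (χ.symm w.1)), w.2))) := by
    intro w h1 h2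
    refine ψ.injOn h1 (hψ _ (φ.map_target h2)) ?_
    rw [hφ _ h2, e.apply_symm_apply]
  have c₁ : Continuous p₁.toFun := p₁.isSubmersion.contMDiff.continuous
  have o₁ : IsOpen (χ.target ∩ χ.symm ⁻¹' (p₁.toFun ⁻¹' ψ.source)) :=
    χ.symm.isOpen_inter_preimage (ψ.open_source.preimage c₁)
  have o₂ : IsOpen {w : ModelSpace n | w.1 ∈ χ.target ∩ χ.symm ⁻¹' (p₁.toFun ⁻¹' ψ.source)} :=
    o₁.preimage continuous_fst
  have c₂ : ContinuousOn (fun w : ModelSpace n => e.symm (ψ (p₁.toFun (χ.symm w.1)), w.2))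
      {w : ModelSpace n | w.1 ∈ χ.target ∩ χ.symm ⁻¹' (p₁.toFun ⁻¹' ψ.source)} := by
    refine e.symm.continuous.comp_continuousOn (ContinuousOn.prodMk ?_ continuous_snd.continuousOn)
    refine ψ.continuousOn.comp (c₁.comp_continuousOn
      (χ.continuousOn_symm.comp continuous_fst.continuousOn fun w hw => hw.1)) fun w hw => hw.2
  { toFun := fun y => (χ y.val.1, (e (φ y.val.2)).2)
    invFun := fun w =>
      if hw : p₁.toFun (χ.symm w.1) =
          p₂.toFun (φ.symm (e.symm (ψ (p₁.toFun (χ.symm w.1)), w.2))) then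
        ⟨(χ.symm w.1, φ.symm (e.symm (ψ (p₁.toFun (χ.symm w.1)), w.2))), hw⟩
      else x
    source := {y | y.val.1 ∈ χ.source ∧ y.val.2 ∈ φ.source}
    target := {w | w.1 ∈ χ.target ∩ χ.symm ⁻¹' (p₁.toFun ⁻¹' ψ.source)} ∩
      {w | e.symm (ψ (p₁.toFun (χ.symm w.1)), w.2) ∈ φ.target}
    map_source' := by
      rintro y ⟨h1, h2⟩
      have hy : p₁.toFun y.val.1 = p₂.toFun y.val.2 := y.property
      have h3 : (ψ (p₂.toFun y.val.2), (e (φ y.val.2)).2) = e (φ y.val.2) :=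
        Prod.ext (by rw [← hφ _ (φ.map_source h2), φ.left_inv h2]) rfl
      refine ⟨⟨χ.map_source h1, ?_⟩, ?_⟩
      · change p₁.toFun (χ.symm (χ y.val.1)) ∈ ψ.source
        rw [χ.left_inv h1, hy]
        exact hψ _ h2
      · change e.symm (ψ (p₁.toFun (χ.symm (χ y.val.1))), (e (φ y.val.2)).2) ∈ φ.target
        rw [χ.left_inv h1, hy, h3, e.symm_apply_apply]
        exact φ.map_source h2
    map_target' := by
      rintro w ⟨⟨h1, h2⟩, h3⟩
      rw [dif_pos (hb w h2 h3)]
      exact ⟨χ.map_target h1, φ.map_target h3⟩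
    left_inv' := by
      rintro y ⟨h1, h2⟩
      have hy : p₁.toFun y.val.1 = p₂.toFun y.val.2 := y.property
      have h3 : (ψ (p₂.toFun y.val.2), (e (φ y.val.2)).2) = e (φ y.val.2) :=
        Prod.ext (by rw [← hφ _ (φ.map_source h2), φ.left_inv h2]) rfl
      have h4 : φ.symm (e.symm (ψ (p₁.toFun (χ.symm (χ y.val.1))), (e (φ y.val.2)).2)) =
          y.val.2 := by
        rw [χ.left_inv h1, hy, h3, e.symm_apply_apply, φ.left_inv h2]
      have h5 : p₁.toFun (χ.symm (χ y.val.1)) = p₂.toFun (φ.symm (e.symm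
          (ψ (p₁.toFun (χ.symm (χ y.val.1))), (e (φ y.val.2)).2))) := by
        rw [h4, χ.left_inv h1, hy]
      rw [dif_pos h5]
      exact ext' (χ.left_inv h1) h4
    right_inv' := by
      rintro w ⟨⟨h1, h2⟩, h3⟩
      rw [dif_pos (hb w h2 h3)]
      refine Prod.ext (χ.right_inv h1) ?_
      change (e (φ (φ.symm (e.symm (ψ (p₁.toFun (χ.symm w.1)), w.2))))).2 = w.2
      rw [φ.right_inv h3, e.apply_symm_apply]
    open_source := (χ.open_source.prod φ.open_source).preimage isInducing_val.continuous
    open_target := c₂.isOpen_inter_preimage o₂ φ.open_target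
    continuousOn_toFun := by
      have cv := (isInducing_val (p₁ := p₁) (p₂ := p₂)).continuous
      refine (χ.continuousOn.comp (continuous_fst.comp cv).continuousOn fun y hy => hy.1).prodMk
        ((continuous_snd.comp e.continuous).comp_continuousOn
          (φ.continuousOn.comp (continuous_snd.comp cv).continuousOn fun y hy => hy.2))
    continuousOn_invFun := by
      rw [isInducing_val.continuousOn_iff]
      have c₃ : ContinuousOn (fun w : ModelSpace n => ((χ.symm w.1,
          φ.symm (e.symm (ψ (p₁.toFun (χ.symm w.1)), w.2))) : SE3 × SE3))
          ({w | w.1 ∈ χ.target ∩ χ.symm ⁻¹' (p₁.toFun ⁻¹' ψ.source)} ∩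
            {w | e.symm (ψ (p₁.toFun (χ.symm w.1)), w.2) ∈ φ.target}) :=
        (χ.continuousOn_symm.comp continuous_fst.continuousOn fun w hw => hw.1.1).prodMk
          (φ.continuousOn_symm.comp (c₂.mono Set.inter_subset_left) fun w hw => hw.2)
      refine c₃.congr fun w hw => ?_
      simp only [Function.comp]
      rw [dif_pos (hb w hw.1.2 hw.2)] }

theorem contMDiffOn_chart_symm_val (x : FiberProduct p₁ p₂) :
    ContMDiffOn 𝓘(ℝ, ModelSpace n) (SE3.model.prod SE3.model) ∞ (fun w => ((chart x).symm w).val)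
      (chart x).target := by
  let h := isSubmersionOfComplement p₂ x.val.2
  let χ : OpenPartialHomeomorph SE3 (E3 × E3) := chartAt (ModelProd E3 E3) x.val.1
  let φ : OpenPartialHomeomorph SE3 (E3 × E3) := h.domChart
  have hχ : ContMDiffOn 𝓘(ℝ, E3 × E3) SE3.model ∞ χ.symm χ.target :=
    (contMDiffOn_extend_symm (I := SE3.model) (n := ∞)
      (IsManifold.chart_mem_maximalAtlas (H := ModelProd E3 E3) x.val.1)).mono fun v hv => ⟨v, hv, rfl⟩
  have hφ : ContMDiffOn 𝓘(ℝ, E3 × E3) SE3.model ∞ φ.symm φ.target :=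
    (contMDiffOn_extend_symm h.domChart_mem_maximalAtlas).mono fun v hv => ⟨v, hv, rfl⟩
  have hψ : ContMDiffOn (𝓡 n) (𝓡 n) ∞ h.codChart h.codChart.source :=
    contMDiffOn_of_mem_maximalAtlas h.codChart_mem_maximalAtlas
  have c₁ : ContMDiffOn 𝓘(ℝ, ModelSpace n) SE3.model ∞ (fun w : ModelSpace n => χ.symm w.1)
      (chart x).target :=
    hχ.comp contDiff_fst.contMDiff.contMDiffOn fun w hw => hw.1.1
  have c₂ : ContMDiffOn 𝓘(ℝ, ModelSpace n) (𝓡 n) ∞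
      (fun w : ModelSpace n => h.codChart (p₁.toFun (χ.symm w.1))) (chart x).target :=
    hψ.comp (p₁.isSubmersion.contMDiff.comp_contMDiffOn c₁) fun w hw => hw.1.2
  have c₃ : ContMDiffOn 𝓘(ℝ, ModelSpace n) 𝓘(ℝ, E3 × E3) ∞
      (fun w : ModelSpace n => h.equiv.symm (h.codChart (p₁.toFun (χ.symm w.1)), w.2))
      (chart x).target :=
    h.equiv.symm.contDiff.contMDiff.comp_contMDiffOn
      (c₂.prodMk_space contDiff_snd.contMDiff.contMDiffOn)
  have c₄ := c₁.prodMk (hφ.comp c₃ fun w hw => hw.2)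
  refine c₄.congr fun w hw => ?_
  have hw' := (chart x).map_target hw
  have e₁ := (chart x).right_inv hw
  set y := (chart x).symm w with hy
  have hy₁ : y.val.1 = χ.symm w.1 := by
    rw [← e₁]
    exact (χ.left_inv hw'.1).symm
  refine Prod.ext hy₁ ?_
  have h3 : h.codChart (p₂.toFun y.val.2) = (h.equiv (φ y.val.2)).1 := by
    have : φ y.val.2 ∈ (h.domChart.extend SE3.model).target := by
      rw [OpenPartialHomeomorph.extend_target]
      exact ⟨φ.map_source hw'.2, ⟨_, rfl⟩⟩
    have h4 := h.writtenInCharts this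
    rw [← show (h.equiv (φ y.val.2)).1 = (Prod.fst ∘ h.equiv) (φ y.val.2) from rfl] at h4
    rw [← h4]
    exact congrArg (fun b => h.codChart (p₂.toFun b)) (φ.left_inv hw'.2).symm
  have h5 : (h.codChart (p₁.toFun (χ.symm w.1)), w.2) = h.equiv (φ y.val.2) :=
    Prod.ext (by rw [← hy₁, y.property, h3]) (by rw [← e₁]; rfl)
  simp only [Function.comp]
  rw [h5, ContinuousLinearEquiv.symm_apply_apply]
  exact (φ.left_inv hw'.2).symm

theorem contMDiffOn_comp_chart {E H M : Type*} [NormedAddCommGroup E] [NormedSpace ℝ E]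
    [TopologicalSpace H] {I : ModelWithCorners ℝ E H} [TopologicalSpace M] [ChartedSpace H M]
    {f : M → FiberProduct p₁ p₂} {s : Set M} (x : FiberProduct p₁ p₂)
    (hf : ContMDiffOn I (SE3.model.prod SE3.model) ∞ (fun z => (f z).val) s)
    (hs : ∀ z ∈ s, f z ∈ (chart x).source) :
    ContMDiffOn I 𝓘(ℝ, ModelSpace n) ∞ (fun z => chart x (f z)) s := by
  let h := isSubmersionOfComplement p₂ x.val.2
  let χ : OpenPartialHomeomorph SE3 (E3 × E3) := chartAt (ModelProd E3 E3) x.val.1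
  let φ : OpenPartialHomeomorph SE3 (E3 × E3) := h.domChart
  have hχ : ContMDiffOn SE3.model 𝓘(ℝ, E3 × E3) ∞ χ χ.source :=
    OpenPartialHomeomorph.contMDiffOn_extend (I := SE3.model) (n := ∞)
      (IsManifold.chart_mem_maximalAtlas (H := ModelProd E3 E3) x.val.1)
  have hφ : ContMDiffOn SE3.model 𝓘(ℝ, E3 × E3) ∞ φ φ.source :=
    OpenPartialHomeomorph.contMDiffOn_extend (I := SE3.model) h.domChart_mem_maximalAtlas
  have c₁ := hχ.comp (contMDiff_fst.comp_contMDiffOn hf) fun z hz => (hs z hz).1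
  have c₂ := hφ.comp (contMDiff_snd.comp_contMDiffOn hf) fun z hz => (hs z hz).2
  exact c₁.prodMk_space
    ((contDiff_snd.comp h.equiv.contDiff).contMDiff.comp_contMDiffOn c₂)

theorem mem_chart_source (x : FiberProduct p₁ p₂) : x ∈ (chart x).source :=
  ⟨_root_.mem_chart_source (ModelProd E3 E3) x.val.1,
    (isSubmersionOfComplement p₂ x.val.2).mem_domChart_source⟩

noncomputable instance : ChartedSpace (ModelSpace n) (FiberProduct p₁ p₂) where
  atlas := Set.range chart
  chartAt := chart
  mem_chart_source := mem_chart_source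
  chart_mem_atlas x := Set.mem_range_self x

instance : IsManifold 𝓘(ℝ, ModelSpace n) ∞ (FiberProduct p₁ p₂) := by
  refine isManifold_of_contDiffOn _ _ _ ?_
  rintro _ _ ⟨x, rfl⟩ ⟨y, rfl⟩
  simp only [modelWithCornersSelf_coe, modelWithCornersSelf_coe_symm, Function.comp_id,
    Function.id_comp, Set.range_id, Set.inter_univ, Set.preimage_id_eq, id_eq]
  rw [← contMDiffOn_iff_contDiffOn]
  exact contMDiffOn_comp_chart y
    ((contMDiffOn_chart_symm_val x).mono fun w hw => hw.1) fun w hw => hw.2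

theorem contMDiff_val : ContMDiff 𝓘(ℝ, ModelSpace n) (SE3.model.prod SE3.model) ∞
    (val : FiberProduct p₁ p₂ → SE3 × SE3) := by
  intro x
  have h1 : ContMDiffOn 𝓘(ℝ, ModelSpace n) 𝓘(ℝ, ModelSpace n) ∞ (chart x) (chart x).source :=
    contMDiffOn_chart (x := x)
  have h2 := ((contMDiffOn_chart_symm_val x).comp h1 fun y hy => (chart x).map_source hy).congr
    (f₁ := val) fun y hy => by simp only [Function.comp, (chart x).left_inv hy]
  exact h2.contMDiffAt ((chart x).open_source.mem_nhds (mem_chart_source x))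

/-- A map into the fibred product is smooth if and only if its two components are, so the fibred
product with its two projections is the pullback of `p₁` and `p₂` in the category of smooth
manifolds. -/
theorem contMDiff_iff {E H M : Type*} [NormedAddCommGroup E] [NormedSpace ℝ E]
    [TopologicalSpace H] {I : ModelWithCorners ℝ E H} [TopologicalSpace M] [ChartedSpace H M]
    {f : M → FiberProduct p₁ p₂} :
    ContMDiff I 𝓘(ℝ, ModelSpace n) ∞ f ↔
      ContMDiff I SE3.model ∞ (fun z => (f z).val.1) ∧
        ContMDiff I SE3.model ∞ (fun z => (f z).val.2) := by
  constructor
  · intro hf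
    have := contMDiff_val.comp hf
    exact ⟨contMDiff_fst.comp this, contMDiff_snd.comp this⟩
  · rintro ⟨hf₁, hf₂⟩ z
    have hv : ContMDiff I (SE3.model.prod SE3.model) ∞ fun z => (f z).val := hf₁.prodMk hf₂
    have hc : Continuous f := isInducing_val.continuous_iff.2 hv.continuous
    have ho : IsOpen (f ⁻¹' (chart (f z)).source) := (chart (f z)).open_source.preimage hc
    have h1 := contMDiffOn_comp_chart (f z) (hv.contMDiffOn (s := f ⁻¹' (chart (f z)).source))
      fun y hy => hy
    have h2 : ContMDiffOn 𝓘(ℝ, ModelSpace n) 𝓘(ℝ, ModelSpace n) ∞ (chart (f z)).symm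
        (chart (f z)).target := contMDiffOn_chart_symm (x := f z)
    have h3 := (h2.comp h1 fun y hy => (chart (f z)).map_source hy).congr (f₁ := f) fun y hy => by
      simp only [Function.comp, (chart (f z)).left_inv hy]
    exact h3.contMDiffAt (ho.mem_nhds (mem_chart_source (f z)))

end FiberProduct
end FiberProduct

/-! Let `H` be the stabilizer of `p₂ 1` and choose `k` with `p₂ k = p₁ 1`. By equivariance `(a, b)`
lies in the fibred product exactly when `k⁻¹ a⁻¹ b ∈ H`, and this element of `H` determines the
orbit of `(a, b)`. An equivariant diffeomorphism with `SE(3) × S¹ × S¹` would restrict on the slice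
`{1} × S¹ × S¹` to a smooth injective map from the torus onto `H`. It remains to see that no
subgroup of `SE(3)` is such an image (`SE3.not_injective_of_range_eq`).

A compact `H` contains no nontrivial translation, so it projects injectively to a subgroup `K` of
`SO(3)`, again a smooth injective image of the torus. The velocities at 1 of `C¹` curves in `K` play
the role of its Lie algebra. They do not span `ℝ³`: otherwise products of three curves would fill an
open set, whereas `K` is a `C¹` image of the plane (`SO3.span_velocities_ne_top`). They therefore
lie in a plane, and invariance under conjugation by `K` forces them to be parallel, because the
cross product of two independent vectors leaves their plane. Integrating along curves, `K` fixes a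
common axis (`SO3.exists_fixed_vector`).

Rotations about a fixed axis near 1 are separated by one real coordinate, so a small disc in the
torus would inject continuously into `ℝ`. This is impossible, since already a circle does not. -/

/-! ### Velocities of curves in a subgroup of SO(3) -/

namespace SO3

/-- The matrix of the linear map `v ↦ w × v`. -/
def crossMatrix (w : Fin 3 → ℝ) : Matrix (Fin 3) (Fin 3) ℝ :=
  !![0, -w 2, w 1; w 2, 0, -w 0; -w 1, w 0, 0]

/-- Twice the axial vector of the skew-symmetric part of a matrix. -/
def skewVector (A : Matrix (Fin 3) (Fin 3) ℝ) : Fin 3 → ℝ :=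
  ![A 2 1 - A 1 2, A 0 2 - A 2 0, A 1 0 - A 0 1]

theorem mul_transpose_self (R : SO3) : R.1 * R.1ᵀ = 1 :=
  (Matrix.mem_orthogonalGroup_iff _ _).1 (Matrix.mem_specialOrthogonalGroup_iff.1 R.2).1

theorem transpose_mul_self (R : SO3) : R.1ᵀ * R.1 = 1 :=
  (Matrix.mem_orthogonalGroup_iff' _ _).1 (Matrix.mem_specialOrthogonalGroup_iff.1 R.2).1

theorem adjugate_eq_transpose (R : SO3) : R.1.adjugate = R.1ᵀ := by
  have h := Matrix.mul_adjugate R.1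
  rw [(Matrix.mem_specialOrthogonalGroup_iff.1 R.2).2, one_smul] at h
  calc R.1.adjugate = (R.1ᵀ * R.1) * R.1.adjugate := by rw [transpose_mul_self, one_mul]
    _ = R.1ᵀ := by rw [mul_assoc, h, mul_one]

/-- A polynomial identity valid for every matrix: the cofactor matrix governs how cross products
transform. For a rotation the cofactor matrix is the rotation itself. -/
theorem mul_crossMatrix_mul_transpose (A : Matrix (Fin 3) (Fin 3) ℝ) (w : Fin 3 → ℝ) :
    A * crossMatrix w * Aᵀ = crossMatrix (A.adjugateᵀ *ᵥ w) := by
  ext i j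
  fin_cases i <;> fin_cases j <;>
    simp [crossMatrix, Matrix.mul_apply, Fin.sum_univ_three, Matrix.adjugate_fin_three,
      Matrix.mulVec, dotProduct] <;> ring

theorem conj_crossMatrix (R : SO3) (w : Fin 3 → ℝ) :
    R.1 * crossMatrix w * R.1ᵀ = crossMatrix (R.1 *ᵥ w) := by
  rw [mul_crossMatrix_mul_transpose, adjugate_eq_transpose, Matrix.transpose_transpose]

/-- The velocity at the identity of a curve of rotations is skew-symmetric. -/
theorem exists_hasDerivAt_crossMatrix {γ : ℝ → SO3} (h1 : γ 0 = 1)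
    (hγ : ∀ i j, DifferentiableAt ℝ (fun t => (γ t).1 i j) 0) :
    ∃ w, ∀ i j, HasDerivAt (fun t => (γ t).1 i j) (crossMatrix w i j) 0 := by
  have h0 (i j : Fin 3) : (γ 0).1 i j = (1 : Matrix (Fin 3) (Fin 3) ℝ) i j := by rw [h1]; rfl
  -- Differentiate `γ γᵀ = 1` at 0, where `γ 0 = 1`.
  have hs (i j : Fin 3) :
      deriv (fun t => (γ t).1 i j) 0 + deriv (fun t => (γ t).1 j i) 0 = 0 := by
    have hd : HasDerivAt (fun t => ∑ k, (γ t).1 i k * (γ t).1 j k)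
        (∑ k, (deriv (fun t => (γ t).1 i k) 0 * (γ 0).1 j k +
          (γ 0).1 i k * deriv (fun t => (γ t).1 j k) 0)) 0 :=
      HasDerivAt.fun_sum fun k _ => (hγ i k).hasDerivAt.mul (hγ j k).hasDerivAt
    have hc : (fun t => ∑ k, (γ t).1 i k * (γ t).1 j k) =
        fun _ => (1 : Matrix (Fin 3) (Fin 3) ℝ) i j := by
      funext t
      rw [← mul_transpose_self (γ t), Matrix.mul_apply]
      rfl
    rw [hc] at hd
    have h := hd.unique (hasDerivAt_const 0 _)
    simp only [h0, Finset.sum_add_distrib, Matrix.one_apply, mul_ite, mul_one, mul_zero, ite_mul,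
      one_mul, zero_mul, Finset.sum_ite_eq, Finset.mem_univ, if_true] at h
    exact h
  let d (i j : Fin 3) : ℝ := deriv (fun t => (γ t).1 i j) 0
  refine ⟨![d 2 1, d 0 2, d 1 0], fun i j => ?_⟩
  have h (i j : Fin 3) : d i j + d j i = 0 := hs i j
  suffices he : crossMatrix ![d 2 1, d 0 2, d 1 0] i j = d i j by
    rw [he]
    exact (hγ i j).hasDerivAt
  fin_cases i <;> fin_cases j <;> simp [crossMatrix] <;>
    linarith [h 0 0, h 1 1, h 2 2, h 0 1, h 0 2, h 1 2]

/-- The velocities at the identity, as axial vectors, of the `C¹` curves in `K`. -/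
def velocities (K : Subgroup SO3) : Set (Fin 3 → ℝ) :=
  {w | ∃ γ : ℝ → SO3, (∀ i j, ContDiff ℝ 1 fun t => (γ t).1 i j) ∧ (∀ t, γ t ∈ K) ∧ γ 0 = 1 ∧
    ∀ i j, HasDerivAt (fun t => (γ t).1 i j) (crossMatrix w i j) 0}

/-- Conjugating a curve in `K` by `R` keeps it in `K` and rotates its axial velocity by `R`; this is
the adjoint action. -/
theorem mulVec_mem_velocities {K : Subgroup SO3} {R : SO3} (hR : R ∈ K) {w : Fin 3 → ℝ}
    (hw : w ∈ velocities K) : R.1 *ᵥ w ∈ velocities K := by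
  obtain ⟨γ, hγ, hK, h1, hd⟩ := hw
  have he (i j : Fin 3) : (fun t => (R * γ t * R⁻¹).1 i j) =
      fun t => ∑ l, (∑ k, R.1 i k * (γ t).1 k l) * R.1 j l := by
    funext t
    change (R.1 * (γ t).1 * R.1ᵀ) i j = _
    simp only [Matrix.mul_apply, Matrix.transpose_apply]
  refine ⟨fun t => R * γ t * R⁻¹, fun i j => ?_,
    fun t => K.mul_mem (K.mul_mem hR (hK t)) (K.inv_mem hR), by simp [h1], fun i j => ?_⟩
  · rw [he]
    exact ContDiff.sum fun l _ =>
      (ContDiff.sum fun k _ => contDiff_const.mul (hγ k l)).mul contDiff_const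
  · rw [he, ← conj_crossMatrix]
    simp only [Matrix.mul_apply, Matrix.transpose_apply]
    exact HasDerivAt.fun_sum fun l _ => HasDerivAt.mul_const
      (HasDerivAt.fun_sum fun k _ => (hd k l).const_mul _) _

/-- The velocity of a curve in `K` is the left translate of a velocity at the identity. -/
theorem exists_mem_velocities {K : Subgroup SO3} {γ : ℝ → SO3}
    (hγ : ∀ i j, ContDiff ℝ 1 fun t => (γ t).1 i j) (hK : ∀ t, γ t ∈ K) (t : ℝ) :
    ∃ w ∈ velocities K, ∀ i j,
      HasDerivAt (fun s => (γ s).1 i j) (((γ t).1 * crossMatrix w) i j) t := by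
  -- The curve `s ↦ γ(t)⁻¹ γ(t + s)` stays in `K` and passes through 1 at `s = 0`.
  have he (i j : Fin 3) : (fun s => ((γ t)⁻¹ * γ (t + s)).1 i j) =
      fun s => ∑ k, (γ t).1 k i * (γ (t + s)).1 k j := by
    funext s
    change ((γ t).1ᵀ * (γ (t + s)).1) i j = _
    simp only [Matrix.mul_apply, Matrix.transpose_apply]
  have hc (i j : Fin 3) : ContDiff ℝ 1 fun s => ((γ t)⁻¹ * γ (t + s)).1 i j := by
    rw [he]
    exact ContDiff.sum fun k _ => contDiff_const.mul
      ((hγ k j).comp (contDiff_const.add contDiff_id))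
  have h1 : (γ t)⁻¹ * γ (t + 0) = 1 := by simp
  obtain ⟨w, hw⟩ := exists_hasDerivAt_crossMatrix (γ := fun s => (γ t)⁻¹ * γ (t + s)) h1
    fun i j => (hc i j).differentiable one_ne_zero 0
  refine ⟨w, ⟨_, hc, fun s => K.mul_mem (K.inv_mem (hK t)) (hK _), h1, hw⟩, fun i j => ?_⟩
  have hd : HasDerivAt (fun s => ∑ k, (γ t).1 i k * ((γ t)⁻¹ * γ (t + s)).1 k j)
      (((γ t).1 * crossMatrix w) i j) 0 := by
    rw [Matrix.mul_apply]
    exact HasDerivAt.fun_sum fun k _ => (hw k j).const_mul _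
  have he' : (fun s => ∑ k, (γ t).1 i k * ((γ t)⁻¹ * γ (t + s)).1 k j) =
      fun s => (γ (t + s)).1 i j := by
    funext s
    rw [← Matrix.mul_apply]
    change (γ t * ((γ t)⁻¹ * γ (t + s))).1 i j = _
    rw [mul_inv_cancel_left]
  rw [he'] at hd
  have := (HasDerivAt.comp_sub_const (f := fun s => (γ (t + s)).1 i j) t t (by simpa using hd))
  simpa using this

/-! ### Planar velocities are parallel and their axis is fixed -/

theorem crossMatrix_mulVec_comm (v w : Fin 3 → ℝ) : crossMatrix v *ᵥ w = -(crossMatrix w *ᵥ v) := by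
  ext i
  fin_cases i <;> simp [crossMatrix, Matrix.mulVec, dotProduct, Fin.sum_univ_three] <;> ring

/-- If `v × w = 0`, then `v` is proportional to `w`. -/
theorem dotProduct_mul_eq {v w : Fin 3 → ℝ} (h : crossMatrix v *ᵥ w = 0) (i : Fin 3) :
    (w ⬝ᵥ w) * v i = (v ⬝ᵥ w) * w i := by
  have h0 := congrFun h 0
  have h1 := congrFun h 1
  have h2 := congrFun h 2
  simp [crossMatrix, Matrix.mulVec, dotProduct, Fin.sum_univ_three] at h0 h1 h2 ⊢
  fin_cases i <;> simp
  · linear_combination w 1 * h2 - w 2 * h1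
  · linear_combination w 2 * h0 - w 0 * h2
  · linear_combination w 0 * h1 - w 1 * h0

theorem crossMatrix_mulVec_eq_zero_of_dotProduct {n v w : Fin 3 → ℝ} (hn : n ≠ 0)
    (hv : n ⬝ᵥ v = 0) (hw : n ⬝ᵥ w = 0) (h : n ⬝ᵥ (crossMatrix v *ᵥ w) = 0) :
    crossMatrix v *ᵥ w = 0 := by
  set u := crossMatrix v *ᵥ w with hu
  -- Triple product expansion: `(v × w) × n = (n · v) w - (n · w) v`. Thus `u` is parallel to `n`,
  -- and being also orthogonal to `n` it vanishes.
  have hnu : crossMatrix u *ᵥ n = 0 := by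
    ext i
    simp [dotProduct, Fin.sum_univ_three] at hv hw
    fin_cases i <;> simp [hu, crossMatrix, Matrix.mulVec, dotProduct, Fin.sum_univ_three]
    · linear_combination w 0 * hv - v 0 * hw
    · linear_combination w 1 * hv - v 1 * hw
    · linear_combination w 2 * hv - v 2 * hw
  have hn' : n ⬝ᵥ n ≠ 0 := fun h => hn (dotProduct_self_eq_zero.1 h)
  ext i
  have := dotProduct_mul_eq hnu i
  rw [dotProduct_comm u, h, zero_mul] at this
  exact (mul_eq_zero.1 this).resolve_left hn'

/-- If a nonzero vector is orthogonal to all velocities, then the velocities are parallel. -/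
theorem crossMatrix_mulVec_velocities {K : Subgroup SO3} {n : Fin 3 → ℝ} (hn : n ≠ 0)
    (h : ∀ w ∈ velocities K, n ⬝ᵥ w = 0) {v w : Fin 3 → ℝ} (hv : v ∈ velocities K)
    (hw : w ∈ velocities K) : crossMatrix v *ᵥ w = 0 := by
  refine crossMatrix_mulVec_eq_zero_of_dotProduct hn (h v hv) (h w hw) ?_
  obtain ⟨γ, -, hK, -, hd⟩ := hv
  -- Each `γ(t) w` is again a velocity, so `n · γ(t) w` is identically zero; its derivative at 0 is
  -- `n · (v × w)`.
  have hd' : HasDerivAt (fun t => ∑ i, n i * ∑ j, (γ t).1 i j * w j)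
      (∑ i, n i * ∑ j, crossMatrix v i j * w j) 0 :=
    HasDerivAt.fun_sum fun i _ => HasDerivAt.const_mul _
      (HasDerivAt.fun_sum fun j _ => (hd i j).mul_const _)
  have hc : (fun t => ∑ i, n i * ∑ j, (γ t).1 i j * w j) = fun _ => 0 := by
    funext t
    exact h _ (mulVec_mem_velocities (hK t) hw)
  rw [hc] at hd'
  exact hd'.unique (hasDerivAt_const 0 _)

/-- The derivative of `γ(t) n` is `γ(t) (w × n)` for some velocity `w`, hence zero. -/
theorem mulVec_eq_of_curve {K : Subgroup SO3} {n : Fin 3 → ℝ}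
    (h : ∀ w ∈ velocities K, crossMatrix w *ᵥ n = 0) {γ : ℝ → SO3}
    (hγ : ∀ i j, ContDiff ℝ 1 fun t => (γ t).1 i j) (hK : ∀ t, γ t ∈ K) (s t : ℝ) :
    (γ s).1 *ᵥ n = (γ t).1 *ᵥ n := by
  ext i
  have hd (t : ℝ) : HasDerivAt (fun t => ∑ j, (γ t).1 i j * n j) 0 t := by
    obtain ⟨w, hw, hd⟩ := exists_mem_velocities hγ hK t
    have h1 : HasDerivAt (fun t => ∑ j, (γ t).1 i j * n j)
        ((((γ t).1 * crossMatrix w) *ᵥ n) i) t :=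
      HasDerivAt.fun_sum fun j _ => (hd i j).mul_const _
    rw [← Matrix.mulVec_mulVec, h w hw, Matrix.mulVec_zero] at h1
    exact h1
  exact is_const_of_deriv_eq_zero (fun t => (hd t).differentiableAt) (fun t => (hd t).deriv) s t

/-! ### Dimension count for a subgroup parametrized by the plane -/

theorem skewVector_crossMatrix (w : Fin 3 → ℝ) : skewVector (crossMatrix w) = (2 : ℝ) • w := by
  ext i
  fin_cases i <;> simp [skewVector, crossMatrix] <;> ring

theorem contDiff_skewVector {E : Type*} [NormedAddCommGroup E] [NormedSpace ℝ E]
    {f : E → Matrix (Fin 3) (Fin 3) ℝ} (hf : ∀ i j, ContDiff ℝ 1 fun x => f x i j) :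
    ContDiff ℝ 1 fun x => skewVector (f x) := by
  rw [contDiff_pi]
  intro i
  fin_cases i
  · exact (hf 2 1).sub (hf 1 2)
  · exact (hf 0 2).sub (hf 2 0)
  · exact (hf 1 0).sub (hf 0 1)

theorem hasDerivAt_skewVector {f : ℝ → Matrix (Fin 3) (Fin 3) ℝ} {A : Matrix (Fin 3) (Fin 3) ℝ}
    {t : ℝ} (hf : ∀ i j, HasDerivAt (fun t => f t i j) (A i j) t) :
    HasDerivAt (fun t => skewVector (f t)) (skewVector A) t := by
  rw [hasDerivAt_pi]
  intro i
  fin_cases i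
  · exact (hf 2 1).sub (hf 1 2)
  · exact (hf 0 2).sub (hf 2 0)
  · exact (hf 1 0).sub (hf 0 1)

/-- The derivative at 0 sends the `k`-th basis vector to `2 w k`, so it is onto when the `w k` span,
and a map with surjective strict derivative is locally onto. -/
theorem range_prod_mem_nhds {γ : Fin 3 → ℝ → SO3}
    (hγ : ∀ k i j, ContDiff ℝ 1 fun t => (γ k t).1 i j) (h1 : ∀ k, γ k 0 = 1)
    {w : Fin 3 → Fin 3 → ℝ} (hw : Submodule.span ℝ (Set.range w) = ⊤)
    (hd : ∀ k i j, HasDerivAt (fun t => (γ k t).1 i j) (crossMatrix (w k) i j) 0) :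
    Set.range (fun x : Fin 3 → ℝ => skewVector (γ 0 (x 0) * γ 1 (x 1) * γ 2 (x 2) : SO3).1) ∈
      nhds (0 : Fin 3 → ℝ) := by
  set F := fun x : Fin 3 → ℝ => skewVector (γ 0 (x 0) * γ 1 (x 1) * γ 2 (x 2) : SO3).1 with hF
  have hm (i j : Fin 3) : ContDiff ℝ 1 fun x : Fin 3 → ℝ =>
      (γ 0 (x 0) * γ 1 (x 1) * γ 2 (x 2) : SO3).1 i j := by
    have he : (fun x : Fin 3 → ℝ => (γ 0 (x 0) * γ 1 (x 1) * γ 2 (x 2) : SO3).1 i j) = fun x =>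
        ∑ l, (∑ k, (γ 0 (x 0)).1 i k * (γ 1 (x 1)).1 k l) * (γ 2 (x 2)).1 l j := by
      funext x
      change ((γ 0 (x 0)).1 * (γ 1 (x 1)).1 * (γ 2 (x 2)).1) i j = _
      simp only [Matrix.mul_apply]
    have hc (k i j : Fin 3) : ContDiff ℝ 1 fun x : Fin 3 → ℝ => (γ k (x k)).1 i j :=
      (hγ k i j).comp (contDiff_apply ℝ ℝ k)
    rw [he]
    exact ContDiff.sum fun l _ => (ContDiff.sum fun k _ => (hc 0 i k).mul (hc 1 k l)).mul (hc 2 l j)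
  have hFs : ContDiff ℝ 1 F := contDiff_skewVector hm
  have hF0 : F 0 = 0 := by
    ext i
    fin_cases i <;> simp [hF, h1, skewVector]
  have hstrict : HasStrictFDerivAt F (fderiv ℝ F 0) 0 :=
    hFs.contDiffAt.hasStrictFDerivAt one_ne_zero
  have hval (k : Fin 3) : fderiv ℝ F 0 (Pi.single k 1) = (2 : ℝ) • w k := by
    have hl : HasDerivAt (fun t : ℝ => t • (Pi.single k 1 : Fin 3 → ℝ)) (Pi.single k 1) 0 := by
      simpa using (hasDerivAt_id (0 : ℝ)).smul_const (Pi.single k 1 : Fin 3 → ℝ)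
    have h0 : HasFDerivAt F (fderiv ℝ F 0) ((0 : ℝ) • (Pi.single k 1 : Fin 3 → ℝ)) := by
      rw [zero_smul]
      exact hstrict.hasFDerivAt
    have hc : HasDerivAt (fun t : ℝ => F (t • Pi.single k 1)) (fderiv ℝ F 0 (Pi.single k 1)) 0 :=
      HasFDerivAt.comp_hasDerivAt (l := F) (l' := fderiv ℝ F 0)
        (f := fun t : ℝ => t • (Pi.single k 1 : Fin 3 → ℝ)) 0 h0 hl
    -- On the `k`-th axis the other two factors equal 1.
    have he : (fun t : ℝ => F (t • Pi.single k 1)) = fun t => skewVector (γ k t).1 := by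
      funext t
      fin_cases k <;> simp [hF, h1]
    rw [he] at hc
    rw [← skewVector_crossMatrix]
    exact hc.unique (hasDerivAt_skewVector (hd k))
  have hsurj : (fderiv ℝ F 0).range = ⊤ := by
    rw [← top_le_iff, ← hw, Submodule.span_le]
    rintro _ ⟨k, rfl⟩
    refine ⟨(2 : ℝ)⁻¹ • Pi.single k 1, ?_⟩
    simp [hval]
  rw [← hF0, ← hstrict.map_nhds_eq_of_surj hsurj]
  exact Filter.range_mem_map

/-- A subgroup of `SO(3)` that is a `C¹` image of the plane has a proper tangent space. -/
theorem span_velocities_ne_top {K : Subgroup SO3} {f : ℝ × ℝ → SO3}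
    (hf : ∀ i j, ContDiff ℝ 1 fun x => (f x).1 i j) (hK : Set.range f = K) :
    Submodule.span ℝ (velocities K) ≠ ⊤ := by
  intro h
  have hb := Submodule.exists_fun_fin_finrank_span_eq ℝ (velocities K)
  rw [h, finrank_top, Module.finrank_fin_fun] at hb
  obtain ⟨w, hw, hsp, -⟩ := hb
  choose γ hγ hγK h1 hd using hw
  have hfs : ContDiff ℝ 1 fun x => skewVector (f x).1 := contDiff_skewVector hf
  -- Sard-type fact: a `C¹` image of `ℝ²` in `ℝ³` has dense complement. Yet it would contain the
  -- neighbourhood of 0 swept out by products of the three curves, as these products lie in `K`.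
  have hdense := hfs.dense_compl_range_of_finrank_lt_finrank (by simp)
  obtain ⟨_, hx, hx'⟩ := hdense.inter_nhds_nonempty (range_prod_mem_nhds hγ h1 hsp hd)
  obtain ⟨x, rfl⟩ := hx'
  have : γ 0 (x 0) * γ 1 (x 1) * γ 2 (x 2) ∈ Set.range f := by
    rw [hK]
    exact K.mul_mem (K.mul_mem (hγK _ _) (hγK _ _)) (hγK _ _)
  obtain ⟨y, hy⟩ := this
  exact hx ⟨y, by simp only [hy]⟩

/-- A subgroup of `SO(3)` that is a `C¹` image of the plane fixes a nonzero vector. -/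
theorem exists_fixed_vector {K : Subgroup SO3} {f : ℝ × ℝ → SO3}
    (hf : ∀ i j, ContDiff ℝ 1 fun x => (f x).1 i j) (hK : Set.range f = K) :
    ∃ n : Fin 3 → ℝ, n ≠ 0 ∧ ∀ R ∈ K, R.1 *ᵥ n = n := by
  obtain ⟨n, hn, hv⟩ : ∃ n : Fin 3 → ℝ, n ≠ 0 ∧ ∀ w ∈ velocities K, crossMatrix w *ᵥ n = 0 := by
    obtain ⟨l, hl, hle⟩ := Submodule.exists_le_ker_of_lt_top _
      (span_velocities_ne_top hf hK).lt_top
    let m : Fin 3 → ℝ := fun i => l (Pi.single i 1)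
    have hlm (w : Fin 3 → ℝ) : m ⬝ᵥ w = l w := by
      rw [LinearMap.pi_apply_eq_sum_univ l w, dotProduct]
      refine Finset.sum_congr rfl fun i _ => ?_
      rw [smul_eq_mul, mul_comm]
      congr 1
      change l _ = l _
      congr 1
      ext j
      simp [Pi.single_apply, eq_comm]
    have hm : m ≠ 0 := by
      intro h
      refine hl (LinearMap.ext fun w => ?_)
      rw [← hlm, h, zero_dotProduct, LinearMap.zero_apply]
    have hw (w) (hw : w ∈ velocities K) : m ⬝ᵥ w = 0 := by
      rw [hlm]
      exact hle (Submodule.subset_span hw)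
    -- The axis is any nonzero velocity; if all velocities vanish, any nonzero vector serves, for
    -- instance `m`.
    by_cases h0 : ∃ w ∈ velocities K, w ≠ 0
    · obtain ⟨w, hwK, hw0⟩ := h0
      exact ⟨w, hw0, fun v hv => crossMatrix_mulVec_velocities hm hw hv hwK⟩
    · push Not at h0
      refine ⟨m, hm, fun w hw => ?_⟩
      rw [h0 w hw, crossMatrix_mulVec_comm]
      simp
  refine ⟨n, hn, fun R hR => ?_⟩
  obtain ⟨x, rfl⟩ : R ∈ Set.range f := hK ▸ hR
  obtain ⟨y, hy⟩ : 1 ∈ Set.range f := hK ▸ K.one_mem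
  -- The image of the segment from `y` to `x` is a curve in `K` from 1 to `R`.
  have h := mulVec_eq_of_curve hv (γ := fun t : ℝ => f (y + t • (x - y)))
    (fun i j => (hf i j).comp (contDiff_const.add (contDiff_id.smul contDiff_const)))
    (fun t => hK.subset ⟨_, rfl⟩) 1 0
  simpa [hy] using h

end SO3

/-! ### A disc does not inject continuously into the line -/

/-- One-dimensional Borsuk–Ulam: `g(z) - g(-z)` changes sign between `1` and `-1`, so it vanishes
somewhere, and `z ≠ -z`. -/
theorem Circle.not_injective_of_continuous_real {g : Circle → ℝ} (hg : Continuous g) :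
    ¬ Function.Injective g := by
  intro hi
  have hc : Continuous fun t : ℝ => g (Circle.exp t) - g (-Circle.exp t) :=
    (hg.comp Circle.exp.continuous).sub (hg.comp Circle.exp.continuous.neg)
  have hpi : Circle.exp Real.pi = -1 := by ext; simp
  obtain ⟨t, ht⟩ : (0 : ℝ) ∈ Set.range fun t : ℝ => g (Circle.exp t) - g (-Circle.exp t) := by
    refine mem_range_of_exists_le_of_exists_ge hc ?_ ?_
    · rcases le_total (g 1) (g (-1)) with h | h
      · exact ⟨0, by simpa using h⟩
      · exact ⟨Real.pi, by simpa [hpi] using h⟩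
    · rcases le_total (g 1) (g (-1)) with h | h
      · exact ⟨Real.pi, by simpa [hpi] using h⟩
      · exact ⟨0, by simpa using h⟩
  have h := congrArg Subtype.val (hi (sub_eq_zero.1 ht))
  have h2 : ((Circle.exp t : Circle) : ℂ) = -(Circle.exp t : Circle) := h
  exact Circle.coe_ne_zero _ (self_eq_neg.1 h2)

theorem not_injOn_ball_of_continuousOn {g : ℝ × ℝ → ℝ} {r : ℝ} (hr : 0 < r)
    (hg : ContinuousOn g (Metric.ball 0 r)) : ¬ Set.InjOn g (Metric.ball 0 r) := by
  intro hi
  -- The circle of radius `r / 2` lies in the ball of the sup norm.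
  let c : Circle → ℝ × ℝ := fun z => (r / 2 * (z : ℂ).re, r / 2 * (z : ℂ).im)
  have hc : Continuous c := by
    refine Continuous.prodMk ?_ ?_
    · exact continuous_const.mul (Complex.continuous_re.comp continuous_subtype_val)
    · exact continuous_const.mul (Complex.continuous_im.comp continuous_subtype_val)
  have hm (z : Circle) : c z ∈ Metric.ball (0 : ℝ × ℝ) r := by
    have h1 := Complex.abs_re_le_norm (z : ℂ)
    have h2 := Complex.abs_im_le_norm (z : ℂ)
    rw [Circle.norm_coe] at h1 h2
    rw [mem_ball_zero_iff, Prod.norm_def, max_lt_iff]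
    simp only [c, Real.norm_eq_abs, abs_mul, abs_of_pos (half_pos hr)]
    constructor <;> nlinarith
  refine Circle.not_injective_of_continuous_real (hg.comp_continuous hc hm) fun z w h => ?_
  have he := hi (hm z) (hm w) h
  have hr' : r / 2 ≠ 0 := (half_pos hr).ne'
  refine Circle.ext (Complex.ext ?_ ?_)
  · exact mul_left_cancel₀ hr' (congrArg Prod.fst he)
  · exact mul_left_cancel₀ hr' (congrArg Prod.snd he)

/-! ### No subgroup of SO(3) is an embedded torus -/

namespace SO3

/-- The cross matrix of the Rodrigues vector is `(1 + tr R)⁻¹ (R - Rᵀ)`, and `R n = n` gives `Rᵀ n =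
n`. If `1 + tr R = 0`, division by zero makes the vector zero and the claim still holds. -/
theorem crossMatrix_rodriguesCoord_mulVec {R : SO3} {n : Fin 3 → ℝ} (h : R.1 *ᵥ n = n) :
    crossMatrix (rodriguesCoord R.1).ofLp *ᵥ n = 0 := by
  have h' : R.1ᵀ *ᵥ n = n := by
    conv_lhs => rw [← h, Matrix.mulVec_mulVec, transpose_mul_self, Matrix.one_mulVec]
  have hd (i : Fin 3) : (R.1 *ᵥ n) i - (R.1ᵀ *ᵥ n) i = 0 := by rw [h, h', sub_self]
  have h0 := hd 0
  have h1 := hd 1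
  have h2 := hd 2
  simp [Matrix.mulVec, dotProduct, Fin.sum_univ_three] at h0 h1 h2
  ext i
  fin_cases i <;>
    simp [crossMatrix, rodriguesCoord, Matrix.mulVec, dotProduct, Fin.sum_univ_three]
  · linear_combination (1 + R.1.trace)⁻¹ * h0
  · linear_combination (1 + R.1.trace)⁻¹ * h1
  · linear_combination (1 + R.1.trace)⁻¹ * h2

/-- The rotations about a fixed axis, other than by the angle `π`, have a real coordinate. -/
theorem eq_of_dotProduct_rodriguesCoord {R S : SO3} {n : Fin 3 → ℝ} (hn : n ≠ 0)
    (hR : R.1 *ᵥ n = n) (hS : S.1 *ᵥ n = n) (hR' : 1 + R.1.trace ≠ 0) (hS' : 1 + S.1.trace ≠ 0)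
    (h : (rodriguesCoord R.1).ofLp ⬝ᵥ n = (rodriguesCoord S.1).ofLp ⬝ᵥ n) : R = S := by
  have hn' : n ⬝ᵥ n ≠ 0 := fun h => hn (dotProduct_self_eq_zero.1 h)
  have he : rodriguesCoord R.1 = rodriguesCoord S.1 := by
    ext i
    refine mul_left_cancel₀ hn' ?_
    rw [dotProduct_mul_eq (crossMatrix_rodriguesCoord_mulVec hR),
      dotProduct_mul_eq (crossMatrix_rodriguesCoord_mulVec hS), h]
  apply Subtype.ext
  rw [← rodrigues_rodriguesCoord R hR', he, rodrigues_rodriguesCoord S hS']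

/-- No subgroup of `SO(3)` is an injectively immersed torus. -/
theorem not_injective_of_range_eq {K : Subgroup SO3} {ρ : Circle × Circle → SO3}
    (hρ : ContMDiff ((𝓡 1).prod (𝓡 1)) (𝓡 3) ∞ ρ) (hK : Set.range ρ = K) :
    ¬ Function.Injective ρ := by
  intro hi
  let f : ℝ × ℝ → SO3 := fun x => ρ (Circle.exp x.1, Circle.exp x.2)
  have hf (i j : Fin 3) : ContDiff ℝ 1 fun x => (f x).1 i j := by
    have he : ContMDiff 𝓘(ℝ, ℝ × ℝ) ((𝓡 1).prod (𝓡 1)) ∞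
        fun x : ℝ × ℝ => (Circle.exp x.1, Circle.exp x.2) :=
      (contMDiff_circleExp.comp contDiff_fst.contMDiff).prodMk
        (contMDiff_circleExp.comp contDiff_snd.contMDiff)
    exact (contMDiff_iff_contDiff.1 (contMDiff_iff.1 (hρ.comp he) i j)).of_le (by simp)
  have hfK : Set.range f = K := by
    rw [← hK]
    refine Set.Subset.antisymm (Set.range_subset_iff.2 fun x => ⟨_, rfl⟩) ?_
    rintro _ ⟨⟨z, w⟩, rfl⟩
    obtain ⟨s, rfl⟩ := Circle.exp_surjective z
    obtain ⟨t, rfl⟩ := Circle.exp_surjective w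
    exact ⟨(s, t), rfl⟩
  obtain ⟨n, hn, hfix⟩ := exists_fixed_vector hf hfK
  obtain ⟨⟨z, w⟩, hzw⟩ : 1 ∈ Set.range ρ := hK ▸ K.one_mem
  obtain ⟨a, rfl⟩ := Circle.exp_surjective z
  obtain ⟨b, rfl⟩ := Circle.exp_surjective w
  have hcf : Continuous fun x : ℝ × ℝ => (f ((a, b) + x)).1 :=
    (continuous_matrix fun i j => (hf i j).continuous).comp (continuous_const.add continuous_id)
  have ho : IsOpen {x : ℝ × ℝ | 1 + (f ((a, b) + x)).1.trace ≠ 0} :=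
    isOpen_ne.preimage (continuous_const.add hcf.matrix_trace)
  have h0 : (0 : ℝ × ℝ) ∈ {x : ℝ × ℝ | 1 + (f ((a, b) + x)).1.trace ≠ 0} := by
    have : f (a, b) = 1 := hzw
    simp only [Set.mem_ofPred_eq, add_zero, this]
    simp
    norm_num
  obtain ⟨r, hr, hball⟩ := Metric.isOpen_iff.1 ho 0 h0
  -- Radius `r` keeps the rotation angle away from `π`; radius at most 1 keeps each angle in an
  -- interval of length `2 < 2π`, where `Circle.exp` is injective.
  have hsub : Metric.ball (0 : ℝ × ℝ) (min r 1) ⊆ Metric.ball 0 r :=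
    Metric.ball_subset_ball (min_le_left _ _)
  refine not_injOn_ball_of_continuousOn (lt_min hr one_pos)
    (g := fun x => (rodriguesCoord (f ((a, b) + x)).1).ofLp ⬝ᵥ n) ?_ fun x hx y hy hxy => ?_
  · have h1 := continuousOn_rodriguesCoord.comp hcf.continuousOn fun x hx => hball (hsub hx)
    exact (Continuous.dotProduct (PiLp.continuous_ofLp 2 _) continuous_const).comp_continuousOn h1
  · have he := hi (eq_of_dotProduct_rodriguesCoord hn (hfix _ (hfK.subset ⟨_, rfl⟩))
      (hfix _ (hfK.subset ⟨_, rfl⟩)) (hball (hsub hx)) (hball (hsub hy)) hxy)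
    have hexp {s t u : ℝ} (hs : ‖s‖ < 1) (ht : ‖t‖ < 1)
        (h : Circle.exp (u + s) = Circle.exp (u + t)) : s = t := by
      rw [Real.norm_eq_abs, abs_lt] at hs ht
      exact add_left_cancel (Circle.exp_injOn_Icc (a := u - 1) (b := u + 1)
        (by linarith [Real.pi_gt_three]) ⟨by linarith, by linarith⟩ ⟨by linarith, by linarith⟩ h)
    have hlt {x : ℝ × ℝ} (hx : x ∈ Metric.ball (0 : ℝ × ℝ) (min r 1)) : ‖x.1‖ < 1 ∧ ‖x.2‖ < 1 := by
      rw [mem_ball_zero_iff] at hx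
      exact max_lt_iff.1 (hx.trans_le (min_le_right _ _))
    exact Prod.ext (hexp (hlt hx).1 (hlt hy).1 (congrArg Prod.fst he))
      (hexp (hlt hx).2 (hlt hy).2 (congrArg Prod.snd he))

end SO3

/-! ### From SE(3) to SO(3) -/

namespace SE3

/-- The rotational part of a rigid motion. -/
noncomputable def rotation : SE3 →* SO3 where
  toFun g := g.2
  map_one' := rfl
  map_mul' _ _ := rfl

theorem pow_of_snd_eq_one {g : SE3} (hg : g.2 = 1) (k : ℕ) : g ^ k = ((k : ℝ) • g.1, 1) := by
  induction k with
  | zero => exact Prod.ext (by simp [one_fst]) (by simp [one_snd])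
  | succ k ih =>
    rw [pow_succ, ih]
    refine Prod.ext ?_ ?_
    · change (k : ℝ) • g.1 + rotate 1 g.1 = _
      rw [rotate_one]
      push_cast
      rw [add_smul, one_smul]
    · change 1 * g.2 = 1
      rw [hg, mul_one]

/-- A compact subgroup of `SE(3)` contains no translation. -/
theorem injOn_rotation_of_isCompact {H : Subgroup SE3} (hH : IsCompact (H : Set SE3)) :
    Set.InjOn rotation H := by
  -- The powers of a translation by `a` are translations by `k a`, which are unbounded unless `a =
  -- 0`.
  have key (g : SE3) (hg : g ∈ H) (h1 : g.2 = 1) : g = 1 := by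
    obtain ⟨C, hC⟩ := (hH.image contMDiff_fst'.continuous).isBounded.exists_norm_le
    have hb (k : ℕ) : k * ‖g.1‖ ≤ C := by
      have := hC _ ⟨g ^ k, H.pow_mem hg k, rfl⟩
      rw [pow_of_snd_eq_one h1] at this
      simpa [norm_smul] using this
    have h0 : ‖g.1‖ = 0 := by
      by_contra hne
      have hpos : 0 < ‖g.1‖ := lt_of_le_of_ne (norm_nonneg _) (Ne.symm hne)
      obtain ⟨k, hk⟩ := exists_nat_gt (C / ‖g.1‖)
      rw [div_lt_iff₀ hpos] at hk
      exact (hk.trans_le (hb k)).false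
    exact Prod.ext (norm_eq_zero.1 h0) h1
  intro g hg h hh hgh
  have := key (g⁻¹ * h) (H.mul_mem (H.inv_mem hg) hh) (by
    change rotation (g⁻¹ * h) = 1
    rw [map_mul, map_inv, hgh, inv_mul_cancel])
  exact inv_mul_eq_one.1 this

/-- No subgroup of `SE(3)` is an injectively immersed torus. -/
theorem not_injective_of_range_eq {H : Subgroup SE3} {φ : Circle × Circle → SE3}
    (hφ : ContMDiff ((𝓡 1).prod (𝓡 1)) model ∞ φ) (hH : Set.range φ = H) :
    ¬ Function.Injective φ := by
  intro hi
  have hc : IsCompact (H : Set SE3) := hH ▸ isCompact_range hφ.continuous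
  refine SO3.not_injective_of_range_eq (K := H.map rotation) (ρ := fun x => rotation (φ x))
    (contMDiff_snd'.comp hφ) ?_ fun x y h => ?_
  · rw [Subgroup.coe_map, ← hH, ← Set.range_comp]
    rfl
  · exact hi (injOn_rotation_of_isCompact hc (hH.subset ⟨x, rfl⟩) (hH.subset ⟨y, rfl⟩) h)

end SE3

/-! ### The slice of the fibred product as a stabilizer -/

theorem mainTheorem5 {n : ℕ} {X : Type*} [TopologicalSpace X] [T2Space X]
    [SecondCountableTopology X] [ChartedSpace (EuclideanSpace ℝ (Fin n)) X]
    [IsManifold (𝓡 n) ∞ X] [MulAction SE3 X] [ContMDiffSMul SE3.model (𝓡 n) ∞ SE3 X]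
    (p₁ p₂ : EquivariantSurjectiveSubmersion n X) :
    ¬ ∃ Φ : Diffeomorph 𝓘(ℝ, FiberProduct.ModelSpace n) (SE3.model.prod ((𝓡 1).prod (𝓡 1)))
        (FiberProduct p₁ p₂) (SE3 × Circle × Circle) ∞,
      ∀ (g : SE3) (x : FiberProduct p₁ p₂), Φ (g • x) = (g * (Φ x).1, (Φ x).2) := by
  rintro ⟨Φ, hΦ⟩
  have hp₁ (g : SE3) : p₁.toFun g = g • p₁.toFun 1 := by
    rw [← p₁.map_smul, smul_eq_mul, mul_one]
  have hp₂ (g : SE3) : p₂.toFun g = g • p₂.toFun 1 := by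
    rw [← p₂.map_smul, smul_eq_mul, mul_one]
  obtain ⟨k, hk⟩ := p₂.surjective (p₁.toFun 1)
  have hk' : k⁻¹ • p₁.toFun 1 = p₂.toFun 1 := by rw [← hk, hp₂ k, inv_smul_smul]
  -- A smooth slice meeting every orbit exactly once.
  let σ (x : Circle × Circle) : FiberProduct p₁ p₂ := Φ.symm (1, x)
  have hσ : ContMDiff ((𝓡 1).prod (𝓡 1)) 𝓘(ℝ, FiberProduct.ModelSpace n) ∞ σ :=
    Φ.symm.contMDiff.comp (contMDiff_const.prodMk contMDiff_id)
  have hΦσ (x : Circle × Circle) : Φ (σ x) = (1, x) := Φ.apply_symm_apply _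
  obtain ⟨h₁, h₂⟩ := FiberProduct.contMDiff_iff.1 hσ
  refine SE3.not_injective_of_range_eq (H := MulAction.stabilizer SE3 (p₂.toFun 1))
    (φ := fun x => k⁻¹ * ((σ x).val.1⁻¹ * (σ x).val.2))
    (contMDiff_const.mul (h₁.inv.mul h₂)) (Set.Subset.antisymm ?_ fun h hh => ?_) fun x y hxy => ?_
  · rintro _ ⟨x, rfl⟩
    have := (σ x).property
    rw [hp₁, hp₂] at this
    change (k⁻¹ * ((σ x).val.1⁻¹ * (σ x).val.2)) • p₂.toFun 1 = p₂.toFun 1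
    rw [mul_smul, mul_smul, ← this, inv_smul_smul, hk']
  · have hh' : h • p₂.toFun 1 = p₂.toFun 1 := hh
    -- Every `h` in the stabilizer comes from the orbit of `(1, k h)`; translating by `(Φ z).1⁻¹`
    -- moves this point into the slice without changing `a⁻¹ b`.
    let z : FiberProduct p₁ p₂ := ⟨(1, k * h), by rw [hp₂, mul_smul, hh', ← hp₂, hk]⟩
    have hz : σ (Φ z).2 = (Φ z).1⁻¹ • z := by
      apply Φ.injective
      change Φ (σ _) = Φ (_ • _)
      rw [hΦσ, hΦ, inv_mul_cancel]
    refine ⟨(Φ z).2, ?_⟩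
    simp only [hz]
    change k⁻¹ * (((Φ z).1⁻¹ * 1)⁻¹ * ((Φ z).1⁻¹ * (k * h))) = h
    group
  · have he : (σ x).val.1⁻¹ * (σ x).val.2 = (σ y).val.1⁻¹ * (σ y).val.2 := mul_left_cancel hxy
    -- Pairs with equal `a⁻¹ b` lie in one orbit, and the torus component of `Φ` is constant on
    -- orbits.
    have hxy' : σ y = ((σ y).val.1 * (σ x).val.1⁻¹) • σ x := by
      refine FiberProduct.ext' ?_ ?_
      · change _ = (σ y).val.1 * (σ x).val.1⁻¹ * (σ x).val.1
        group
      · change _ = (σ y).val.1 * (σ x).val.1⁻¹ * (σ x).val.2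
        rw [mul_assoc, he, mul_inv_cancel_left]
    have := congrArg (fun z => (Φ z).2) hxy'
    simpa [hΦ, hΦσ] using this.symm
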